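/- A \emph{stochastic game with rewards} consists of a finite set $V$ of vertices partitioned into $V_1, V_2, V_{\mathsf P}$, a map $\delta : V\times V\to[0,1]$ with $\delta(v,v')\in\{0,1\}$ for $v\in V_1\cup V_2$ and $\sum_{v'}\delta(v,v')=1$ for $v\in V_{\mathsf P}$, such that $\mathrm{post}(v)=\{v' : \delta(v,v')>0\}$ is non-empty for every $v$, and a reward function $r:V\to[0,\infty)$ that vanishes on the set $T$ of terminal vertices, i.e. of the $v$ with $\delta(v,v)=1$ and $\delta(v,v')=0$ for all $v'\ne v$. A path is a sequence $\omega\in V^{\mathbb N}$ with $\delta(\omega_k,\omega_{k+1})>0$ for all $k$. A strategy of Player $i\in\{1,2\}$ assigns to every finite sequence of vertices that ends in a vertex $v \in V_i$ a probability distribution on $V$ supported in $\mathrm{post}(v)$; it may be randomized and history-dependent. It is deterministic if all these distributions are Dirac, and memoryless if they depend on $v$ only. Let $\Pi_i$ be the set of strategies of Player $i$. Strategies $\pi_1\in\Pi_1,\pi_2\in\Pi_2$ and an initial vertex $v$ induce a probability measure $\mathbb P^{\pi_1,\pi_2}_v$ on $V^{\mathbb N}$, where the next vertex is drawn according to $\pi_1$,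 $\pi_2$ or $\delta$ as the current vertex is in $V_1$, $V_2$ or $V_{\mathsf P}$; let $\mathbb E^{\pi_1,\pi_2}_v$ be the expectation. A strategy $\pi_2\in\Pi_2$ is \emph{fair} if, for all $\pi_1\in\Pi_1$ and $v\in V$, $\mathbb P^{\pi_1,\pi_2}_v$-almost every $\omega$ is a path with the property that whenever some $v'\in V_2$ occurs infinitely often in $\omega$, so does every element of $\mathrm{post}(v')$. Let $\Pi_2^{F}$ be the set of fair strategies. The game is \emph{stopping under fairness} if $\mathbb P^{\pi_1,\pi_2}_v(\exists n:\omega_n\in T)=1$ for all $\pi_1\in\Pi_1$, $\pi_2\in\Pi_2^{F}$, $v\in V$. Let $\mathrm{rew}(\omega)=\sum_{n\ge0}r(\omega_n)\in[0,\infty]$. Let $\Pi_1^{DM}\subseteq\Pi_1$ and $\Pi_2^{DMF}\subseteq\Pi_2^{F}$ be the subsets of deterministic memoryless strategies, let $$\mathbf U=\max_{v\in V}\ \inf_{\pi_2\in\Pi_2^{DMF}}\ \sup_{\pi_1\in\Pi_1^{DM}}\mathbb E^{\pi_1,\pi_2}_v[\mathrm{rew}],$$ and for $f:V\to[0,\infty]$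 let $$\Gamma(f)(v)=\begin{cases}0 & v\in T,\\ r(v)+\sum_{v'\in\mathrm{post}(v)}\delta(v,v')f(v') & v\in V_{\mathsf P}\setminus T,\\ \max\{r(v)+f(v') : v'\in\mathrm{post}(v)\} & v\in V_1\setminus T,\\ \min\{r(v)+f(v') : v'\in\mathrm{post}(v)\} & v\in V_2\setminus T.\end{cases}$$ \textbf{Theorem.} Let a stochastic game with rewards be stopping under fairness. Then $\mathbf U<\infty$, the set of all $f\in[0,\mathbf U]^V$ with $\Gamma(f)=f$ has a greatest element $\nu\Gamma$ for the pointwise order, and for every $v\in V$ $$\inf_{\pi_2\in\Pi_2^{F}}\ \sup_{\pi_1\in\Pi_1}\mathbb E^{\pi_1,\pi_2}_v[\mathrm{rew}]=\sup_{\pi_1\in\Pi_1}\ \inf_{\pi_2\in\Pi_2^{F}}\mathbb E^{\pi_1,\pi_2}_v[\mathrm{rew}]=\nu\Gamma(v).$$ -/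

import Mathlib

open MeasureTheory ProbabilityTheory
open scoped ENNReal NNReal

/-- Who controls a vertex: Player 1, Player 2, or chance. -/
inductive VertexKind where
  | player1
  | player2
  | random

/-- A stochastic game on a finite vertex set `V`, partitioned into the vertices of Player 1,
of Player 2 and the probabilistic ones by `kind`. The axioms imply `δ v v' ≤ 1`. -/
structure StochasticGame (V : Type*) [Fintype V] where
  kind : V → VertexKind
  δ : V → V → ℝ≥0
  δ_player1 : ∀ v, kind v = VertexKind.player1 → ∀ v', δ v v' = 0 ∨ δ v v' = 1
  δ_player2 : ∀ v, kind v = VertexKind.player2 → ∀ v', δ v v' = 0 ∨ δ v v' = 1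
  δ_random : ∀ v, kind v = VertexKind.random → ∑ v', δ v v' = 1
  exists_succ : ∀ v, ∃ v', 0 < δ v v'

namespace StochasticGame

variable {V : Type*} [Fintype V] (G : StochasticGame V)

/-- The set of successors of a vertex. -/
def post (v : V) : Set V := {v' | 0 < G.δ v v'}

/-- The set of terminal vertices. -/
def terminal : Set V := {v | G.δ v v = 1 ∧ ∀ v', v' ≠ v → G.δ v v' = 0}

/-- Infinite paths of the game. -/
def paths : Set (ℕ → V) := {ω | ∀ k, 0 < G.δ (ω k) (ω (k + 1))}

/-- Strategies of the player controlling the vertices of kind `i`: to every finite sequence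
`h` of vertices followed by a vertex `v` of kind `i` they assign a probability distribution on
the vertices that is supported in `post v`. -/
structure Strategy (i : VertexKind) where
  move : List V → {v : V // G.kind v = i} → PMF V
  support_subset : ∀ h v, (move h v).support ⊆ G.post v

variable {G} in
/-- Pure strategies: all choices are Dirac distributions. -/
def Strategy.Deterministic {i : VertexKind} (σ : G.Strategy i) : Prop :=
  ∀ h v, ∃ v', σ.move h v = PMF.pure v'

variable {G} in
/-- Strategies whose choices depend on the current vertex only. -/
def Strategy.Memoryless {i : VertexKind} (σ : G.Strategy i) : Prop :=
  ∀ h v, σ.move h v = σ.move [] v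

abbrev Strategy1 := G.Strategy VertexKind.player1

abbrev Strategy2 := G.Strategy VertexKind.player2

/-- The distribution of the next vertex at a probabilistic vertex. -/
noncomputable def randomStep (v : V) (hv : G.kind v = VertexKind.random) : PMF V :=
  PMF.ofFintype (fun v' => (G.δ v v' : ℝ≥0∞)) (by
    rw [← ENNReal.ofNNReal_finsetSum, G.δ_random v hv, ENNReal.coe_one])

variable {G} in
/-- The distribution of the next vertex after the history `h` followed by the current
vertex `v`. -/
noncomputable def step (σ₁ : G.Strategy1) (σ₂ : G.Strategy2) (h : List V) (v : V) : PMF V :=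
  match hv : G.kind v with
  | VertexKind.player1 => σ₁.move h ⟨v, hv⟩
  | VertexKind.player2 => σ₂.move h ⟨v, hv⟩
  | VertexKind.random => G.randomStep v hv

variable [MeasurableSpace V] [DiscreteMeasurableSpace V]

variable {G} in
/-- The transition kernel from the first `n + 1` vertices of a play to the next vertex. -/
noncomputable def stepKernel (σ₁ : G.Strategy1) (σ₂ : G.Strategy2) (n : ℕ) :
    Kernel ((_ : Finset.Iic n) → V) V where
  toFun x := (step σ₁ σ₂
    (List.ofFn fun k : Fin n => x ⟨k, Finset.mem_Iic.2 k.isLt.le⟩)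
    (x ⟨n, Finset.mem_Iic.2 le_rfl⟩)).toMeasure
  measurable' := Measurable.of_discrete

instance isMarkovKernel_stepKernel (σ₁ : G.Strategy1) (σ₂ : G.Strategy2) (n : ℕ) :
    IsMarkovKernel (stepKernel σ₁ σ₂ n) :=
  ⟨fun _ => PMF.toMeasure.isProbabilityMeasure _⟩

variable {G} in
/-- The law on `V^∞` of the play that starts in `v` when the players use `σ₁` and `σ₂`. -/
noncomputable def prob (σ₁ : G.Strategy1) (σ₂ : G.Strategy2) (v : V) : Measure (ℕ → V) :=
  Kernel.traj (X := fun _ => V) (stepKernel σ₁ σ₂) 0 (fun _ => v)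

/-- Plays fair for Player 2: if a Player 2 vertex is visited infinitely often, then so are all
its successors. -/
def fairPaths : Set (ℕ → V) :=
  {ω | ω ∈ G.paths ∧ ∀ v, G.kind v = VertexKind.player2 →
    (∃ᶠ n in Filter.atTop, ω n = v) → ∀ v' ∈ G.post v, ∃ᶠ n in Filter.atTop, ω n = v'}

/-- Plays that reach a terminal vertex. -/
def reachTerminal : Set (ℕ → V) := {ω | ω ∈ G.paths ∧ ∃ n, ω n ∈ G.terminal}

/-- The (almost-sure) fair strategies of Player 2. -/
def fairStrategies : Set G.Strategy2 :=
  {σ₂ | ∀ (σ₁ : G.Strategy1) (v : V), prob σ₁ σ₂ v G.fairPaths = 1}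

/-- The game almost surely reaches a terminal vertex whenever Player 2 plays fairly. -/
def StoppingUnderFairness : Prop :=
  ∀ (σ₁ : G.Strategy1), ∀ σ₂ ∈ G.fairStrategies, ∀ v : V, prob σ₁ σ₂ v G.reachTerminal = 1

/-- The deterministic memoryless strategies of Player 1. -/
def detMemoryless1 : Set G.Strategy1 := {σ₁ | σ₁.Deterministic ∧ σ₁.Memoryless}

/-- The deterministic memoryless fair strategies of Player 2. -/
def detMemorylessFair2 : Set G.Strategy2 :=
  {σ₂ | σ₂.Deterministic ∧ σ₂.Memoryless ∧ σ₂ ∈ G.fairStrategies}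

end StochasticGame

/-- A stochastic game with non-negative rewards that vanish at the terminal vertices. -/
structure RewardGame (V : Type*) [Fintype V] extends StochasticGame V where
  r : V → ℝ≥0
  r_terminal : ∀ v ∈ toStochasticGame.terminal, r v = 0

namespace RewardGame

variable {V : Type*} [Fintype V] (G : RewardGame V)

/-- The total accumulated reward of a play. -/
noncomputable def rew (ω : ℕ → V) : ℝ≥0∞ := ∑' n, (G.r (ω n) : ℝ≥0∞)

open Classical in
/-- The Bellman functional. The suprema and infima range over finite non-empty sets. -/
noncomputable def bellman (f : V → ℝ≥0∞) (v : V) : ℝ≥0∞ :=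
  if v ∈ G.terminal then 0
  else match G.kind v with
    | VertexKind.player1 => ⨆ v' ∈ G.post v, ((G.r v : ℝ≥0∞) + f v')
    | VertexKind.player2 => ⨅ v' ∈ G.post v, ((G.r v : ℝ≥0∞) + f v')
    | VertexKind.random => (G.r v : ℝ≥0∞) + ∑ v', (G.δ v v' : ℝ≥0∞) * f v'

variable [MeasurableSpace V] [DiscreteMeasurableSpace V]

/-- The expected total reward; it may be infinite. -/
noncomputable def expRew (σ₁ : G.Strategy1) (σ₂ : G.Strategy2) (v : V) : ℝ≥0∞ :=
  ∫⁻ ω, G.rew ω ∂(StochasticGame.prob σ₁ σ₂ v)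

/-- The value for Player 2 at `v`, Player 2 being restricted to fair strategies. -/
noncomputable def upperValue (v : V) : ℝ≥0∞ :=
  ⨅ σ₂ ∈ G.fairStrategies, ⨆ σ₁ : G.Strategy1, G.expRew σ₁ σ₂ v

/-- The value for Player 1 at `v`, Player 2 being restricted to fair strategies. -/
noncomputable def lowerValue (v : V) : ℝ≥0∞ :=
  ⨆ σ₁ : G.Strategy1, ⨅ σ₂ ∈ G.fairStrategies, G.expRew σ₁ σ₂ v

/-- The bound `U`: the maximum over the vertices of the inf-sup over deterministic memoryless
strategies, fair for Player 2. -/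
noncomputable def bound : ℝ≥0∞ :=
  ⨆ v : V, ⨅ σ₂ ∈ G.detMemorylessFair2, ⨆ σ₁ ∈ G.detMemoryless1, G.expRew σ₁ σ₂ v

/-- The fixed points of the Bellman functional in `[0, U]^V`. -/
def bellmanFixedPoints : Set (V → ℝ≥0∞) :=
  {f | (∀ v, f v ≤ G.bound) ∧ G.bellman f = f}

end RewardGame

/-! The proof compares the upper value `u` with functions `f` satisfying `f ≤ Γ f`, where `Γ` is the
Bellman functional.

Finite subsolutions are guaranteed by Player 1. If `f ≤ Γ f` and Player 1 always moves to a
successor maximizing `f`, then `f v` is at most the expected reward of the first `n` steps plus the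
mean of `f (ω n)`. Against a fair strategy the play is almost surely absorbed in a terminal vertex,
where `f` vanishes, so the last term tends to `0` by dominated convergence. Hence `f` lies below the
lower value, and also below `U`, because this strategy is deterministic and memoryless
(`exists_detMemoryless1_forall_le_expRew`).

The upper value is a finite subsolution. Finiteness: stopping puts every vertex in Player 2's
positive-probability attractor of the terminal set. Moving down the attractor rank bounds the
expected absorption time through a potential, and almost sure absorption makes this memoryless
strategy fair (`exists_detMemorylessFair2`). The inequality `u ≤ Γ u`: Player 2 makes one minimizing
move and continues with nearly optimal fair strategies; a changed first move preserves fairness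
(`upperValue_le_bellman`).

Therefore `u` is at most the lower value, and the two agree. By monotonicity `Γ u` is again a finite
subsolution, so `Γ u ≤ u` and `u` is a fixed point. Fixed points bounded by the finite `U` are
finite subsolutions, hence at most `u`. -/

/-! ### Processes with history-dependent transitions, and their first-step decomposition. -/

section HistoryProcess

/-- The sequence `ω` with `v` put in front. -/
def prependSeq {V : Type*} (v : V) (ω : ℕ → V) : ℕ → V
  | 0 => v
  | n + 1 => ω n

/-- The sequences that agree with `y` up to time `n`. -/
def agreeUpTo {V : Type*} (y : ℕ → V) (n : ℕ) : Set (ℕ → V) := {ω | ∀ k ≤ n, ω k = y k}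

theorem preimage_prependSeq_agreeUpTo {V : Type*} (y : ℕ → V) (n : ℕ) :
    prependSeq (y 0) ⁻¹' agreeUpTo y (n + 1) = agreeUpTo (fun k => y (k + 1)) n := by
  ext ω
  constructor
  · intro h k hk
    exact h (k + 1) (by omega)
  · intro h k hk
    cases k with
    | zero => rfl
    | succ k => exact h k (by omega)

theorem measurable_prependSeq {V : Type*} [MeasurableSpace V] (v : V) : Measurable (prependSeq v) := by
  refine measurable_pi_iff.2 fun n => ?_
  cases n with
  | zero => exact measurable_const
  | succ n => exact measurable_pi_apply n

theorem frestrictLe_preimage_singleton {V : Type*} (y : ℕ → V) (n : ℕ) :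
    Preorder.frestrictLe (π := fun _ => V) n ⁻¹' {Preorder.frestrictLe (π := fun _ => V) n y}
      = agreeUpTo y n := by
  ext ω
  simp only [Set.mem_preimage, Set.mem_singleton_iff, agreeUpTo, Set.mem_ofPred_eq, funext_iff,
    Preorder.frestrictLe_apply, Subtype.forall, Finset.mem_Iic]

theorem measurableSet_agreeUpTo {V : Type*} [MeasurableSpace V]
    [DiscreteMeasurableSpace V] (y : ℕ → V) (n : ℕ) :
    MeasurableSet (agreeUpTo y n) := by
  have : agreeUpTo y n = ⋂ k, ⋂ _ : k ≤ n, (fun ω : ℕ → V => ω k) ⁻¹' {y k} := by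
    ext ω; simp [agreeUpTo]
  rw [this]
  exact MeasurableSet.iInter fun k => MeasurableSet.iInter fun _ =>
    measurable_pi_apply k (measurableSet_singleton _)

variable {V : Type*} [Fintype V] [MeasurableSpace V] [DiscreteMeasurableSpace V]

/-- The transition kernels of the process whose next step after the history `h` and the current
state `v` has law `q h v`. -/
noncomputable def historyKernel (q : List V → V → PMF V) (n : ℕ) :
    Kernel ((_ : Finset.Iic n) → V) V where
  toFun x := (q (List.ofFn fun k : Fin n => x ⟨k, Finset.mem_Iic.2 k.isLt.le⟩)
    (x ⟨n, Finset.mem_Iic.2 le_rfl⟩)).toMeasure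
  measurable' := Measurable.of_discrete

instance isMarkovKernel_historyKernel (q : List V → V → PMF V) (n : ℕ) :
    IsMarkovKernel (historyKernel q n) :=
  ⟨fun _ => PMF.toMeasure.isProbabilityMeasure _⟩

/-- The law of the process started in `v` whose next step after the history `h` and the current
state `w` has law `q h w`. -/
noncomputable def historyLaw (q : List V → V → PMF V) (v : V) : Measure (ℕ → V) :=
  Kernel.traj (X := fun _ => V) (historyKernel q) 0 (fun _ => v)

instance isProbabilityMeasure_historyLaw (q : List V → V → PMF V) (v : V) :
    IsProbabilityMeasure (historyLaw q v) := by
  unfold historyLaw; infer_instance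

theorem historyLaw_agreeUpTo_succ (q : List V → V → PMF V) (v : V) (y : ℕ → V) (n : ℕ) :
    historyLaw q v (agreeUpTo y (n + 1)) = historyLaw q v (agreeUpTo y n) *
      q (List.ofFn fun k : Fin n => y k) (y n) (y (n + 1)) := by
  have key := Kernel.partialTraj_compProd_eq_map_traj (X := fun _ => V) (κ := historyKernel q)
    (Nat.zero_le n) (x₀ := fun _ => v)
  have h1 : agreeUpTo y (n + 1) =
      (fun x : ℕ → V => (Preorder.frestrictLe (π := fun _ => V) n x, x (n + 1))) ⁻¹'
        ({Preorder.frestrictLe (π := fun _ => V) n y} ×ˢ {y (n + 1)}) := by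
    ext ω
    have := congrArg (ω ∈ ·) (frestrictLe_preimage_singleton y n)
    simp only [Set.mem_preimage, Set.mem_singleton_iff] at this
    simp only [Set.mem_preimage, Set.mem_prod, Set.mem_singleton_iff, this]
    constructor
    · exact fun h => ⟨fun k hk => h k (by omega), h _ le_rfl⟩
    · rintro ⟨h, h'⟩ k hk
      rcases Nat.lt_or_ge n k with hk' | hk'
      · obtain rfl : k = n + 1 := by omega
        exact h'
      · exact h k hk'
  have hm : Measurable
      (fun x : ℕ → V => (Preorder.frestrictLe (π := fun _ => V) n x, x (n + 1))) := by fun_prop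
  have hs : MeasurableSet ({Preorder.frestrictLe (π := fun _ => V) n y} ×ˢ {y (n + 1)}) :=
    (measurableSet_singleton _).prod (measurableSet_singleton _)
  rw [h1, historyLaw, ← Measure.map_apply hm hs, ← key, Measure.compProd_apply_prod
    (measurableSet_singleton _) (measurableSet_singleton _), lintegral_singleton,
    ← Kernel.traj_map_frestrictLe_apply, Measure.map_apply (by fun_prop)
    (measurableSet_singleton _), frestrictLe_preimage_singleton, mul_comm]
  congr 1
  exact PMF.toMeasure_apply_singleton _ _ (measurableSet_singleton _)

theorem historyLaw_agreeUpTo_zero (q : List V → V → PMF V) (y : ℕ → V) :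
    historyLaw q (y 0) (agreeUpTo y 0) = 1 := by
  rw [← frestrictLe_preimage_singleton, ← Measure.map_apply (by fun_prop)
    (measurableSet_singleton _), historyLaw, Kernel.traj_map_frestrictLe_apply,
    Kernel.partialTraj_self, Kernel.id_apply,
    Measure.dirac_apply' _ (measurableSet_singleton _), Set.indicator_of_mem, Pi.one_apply]
  rw [Set.mem_singleton_iff]
  funext ⟨k, hk⟩
  have : k = 0 := by simpa using hk
  subst this
  rfl

theorem ae_historyLaw_zero (q : List V → V → PMF V) (v : V) :
    ∀ᵐ ω ∂historyLaw q v, ω 0 = v := by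
  have h := historyLaw_agreeUpTo_zero q (fun _ => v)
  have h' := (mem_ae_iff_prob_eq_one (measurableSet_agreeUpTo _ _)).2 h
  filter_upwards [h'] with ω hω using hω 0 le_rfl

theorem historyLaw_agreeUpTo_of_ne (q : List V → V → PMF V) {v : V} {y : ℕ → V}
    (h : y 0 ≠ v) (n : ℕ) : historyLaw q v (agreeUpTo y n) = 0 := by
  have : ∀ᵐ ω ∂historyLaw q v, ω ∉ agreeUpTo y n := by
    filter_upwards [ae_historyLaw_zero q v] with ω hω hc
    exact h ((hc 0 (Nat.zero_le _)).symm.trans hω)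
  simpa [ae_iff] using this

/-- As `V` is finite, the law of an initial segment is determined by its atoms, which are these
cylinders. Every finite set of times lies in an initial segment, so all finite-dimensional marginals
agree, and projective limits are unique. -/
theorem measure_ext_of_agreeUpTo {μ ν : Measure (ℕ → V)} [IsFiniteMeasure μ]
    (h : ∀ y n, μ (agreeUpTo y n) = ν (agreeUpTo y n)) : μ = ν := by
  have hn : ∀ n, μ.map (Preorder.frestrictLe (π := fun _ => V) n)
      = ν.map (Preorder.frestrictLe (π := fun _ => V) n) := by
    intro n
    refine Measure.ext_of_singleton fun x => ?_
    obtain ⟨y, rfl⟩ : ∃ y : ℕ → V, Preorder.frestrictLe (π := fun _ => V) n y = x := by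
      refine ⟨fun k => x ⟨min k n, Finset.mem_Iic.2 (min_le_right _ _)⟩, ?_⟩
      funext ⟨k, hk⟩
      have : min k n = k := min_eq_left (Finset.mem_Iic.1 hk)
      simp [Preorder.frestrictLe_apply, this]
    rw [Measure.map_apply (by fun_prop) (measurableSet_singleton _),
      Measure.map_apply (by fun_prop) (measurableSet_singleton _),
      frestrictLe_preimage_singleton, h]
  have hI : ∀ I : Finset ℕ, ν.map I.restrict = μ.map I.restrict := by
    intro I
    have hsub : I ⊆ Finset.Iic (I.sup id) := fun i hi => Finset.mem_Iic.2 (Finset.le_sup (f := id) hi)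
    have hf : (I.restrict : (ℕ → V) → _) =
        Finset.restrict₂ (π := fun _ => V) hsub ∘
          Preorder.frestrictLe (π := fun _ => V) (I.sup id) := rfl
    rw [hf, ← Measure.map_map (by fun_prop) (by fun_prop), ← hn,
      Measure.map_map (by fun_prop) (by fun_prop)]
  exact IsProjectiveLimit.unique (P := fun I : Finset ℕ => μ.map (I.restrict : (ℕ → V) → _))
    (fun _ => rfl) (fun I => hI I)

/-- Histories that do not begin with `v` are never seen by the process. This allows a strategy to
consult the starting vertex without changing the law (`prob_consFamily_tail`). -/
theorem historyLaw_congr {q q' : List V → V → PMF V} {v : V}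
    (h : ∀ l w, (l ++ [w]).head? = some v → q l w = q' l w) : historyLaw q v = historyLaw q' v := by
  refine measure_ext_of_agreeUpTo fun y n => ?_
  by_cases hy : y 0 = v
  · subst hy
    induction n with
    | zero => rw [historyLaw_agreeUpTo_zero, historyLaw_agreeUpTo_zero]
    | succ n ih =>
      rw [historyLaw_agreeUpTo_succ, historyLaw_agreeUpTo_succ, ih, h]
      cases n <;> simp [List.ofFn_succ]
  · rw [historyLaw_agreeUpTo_of_ne _ hy, historyLaw_agreeUpTo_of_ne _ hy]

/-- A cylinder has as its probability a product of transition probabilities; here the first factor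
is split off instead of the last, the rest belonging to the process with `y 0` stored in its
history. -/
theorem historyLaw_agreeUpTo_succ_eq_mul (q : List V → V → PMF V) (y : ℕ → V) (n : ℕ) :
    historyLaw q (y 0) (agreeUpTo y (n + 1)) = q [] (y 0) (y 1) *
      historyLaw (fun l => q (y 0 :: l)) (y 1) (agreeUpTo (fun k => y (k + 1)) n) := by
  induction n with
  | zero =>
    rw [historyLaw_agreeUpTo_succ, historyLaw_agreeUpTo_zero,
      historyLaw_agreeUpTo_zero _ (fun k => y (k + 1))]
    simp
  | succ n ih =>
    rw [historyLaw_agreeUpTo_succ, ih, historyLaw_agreeUpTo_succ, mul_assoc]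
    simp [List.ofFn_succ]

/-- Decomposition of the law of the process according to its first step. -/
theorem historyLaw_eq_sum (q : List V → V → PMF V) (v : V) :
    historyLaw q v = ∑ w, q [] v w •
      (historyLaw (fun l => q (v :: l)) w).map (prependSeq v) := by
  refine measure_ext_of_agreeUpTo fun y n => ?_
  rw [Measure.finsetSum_apply]
  simp only [Measure.smul_apply, smul_eq_mul,
    Measure.map_apply (measurable_prependSeq v) (measurableSet_agreeUpTo _ _)]
  by_cases hy : y 0 = v
  · subst hy
    cases n with
    | zero =>
      have : prependSeq (y 0) ⁻¹' agreeUpTo y 0 = Set.univ := by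
        ext ω; simp [agreeUpTo, prependSeq]
      simp only [this, measure_univ, mul_one]
      rw [historyLaw_agreeUpTo_zero, ← tsum_fintype (L := .unconditional V), PMF.tsum_coe]
    | succ n =>
      rw [historyLaw_agreeUpTo_succ_eq_mul]
      simp only [preimage_prependSeq_agreeUpTo]
      rw [Finset.sum_eq_single (y 1)]
      · intro w _ hw
        rw [historyLaw_agreeUpTo_of_ne, mul_zero]
        exact hw.symm
      · simp
  · have : prependSeq v ⁻¹' agreeUpTo y n = ∅ := by
      ext ω
      simp only [Set.mem_preimage, Set.mem_empty_iff_false, iff_false]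
      exact fun h => hy (h 0 (Nat.zero_le _)).symm
    rw [historyLaw_agreeUpTo_of_ne _ hy]
    simp [this]

theorem lintegral_historyLaw (q : List V → V → PMF V) (v : V) {F : (ℕ → V) → ℝ≥0∞}
    (hF : Measurable F) :
    ∫⁻ ω, F ω ∂historyLaw q v = ∑ w, q [] v w *
      ∫⁻ ω, F (prependSeq v ω) ∂historyLaw (fun l => q (v :: l)) w := by
  rw [historyLaw_eq_sum, lintegral_finsetSum_measure]
  refine Finset.sum_congr rfl fun w _ => ?_
  rw [lintegral_smul_measure, lintegral_map hF (measurable_prependSeq v), smul_eq_mul]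

theorem ae_historyLaw_of_forall {q : List V → V → PMF V} {v : V} {p : (ℕ → V) → Prop}
    (hp : MeasurableSet {ω | p ω})
    (h : ∀ w ∈ (q [] v).support,
      ∀ᵐ ω ∂historyLaw (fun l => q (v :: l)) w, p (prependSeq v ω)) :
    ∀ᵐ ω ∂historyLaw q v, p ω := by
  rw [ae_iff, historyLaw_eq_sum, Measure.finsetSum_apply]
  refine Finset.sum_eq_zero fun w _ => ?_
  have hp' : MeasurableSet {ω | ¬ p ω} := hp.compl
  rw [Measure.smul_apply, Measure.map_apply (measurable_prependSeq v) hp', smul_eq_mul]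
  by_cases hw : q [] v w = 0
  · rw [hw, zero_mul]
  · have := h w ((PMF.mem_support_iff _ _).2 hw)
    rw [ae_iff] at this
    rw [show prependSeq v ⁻¹' {a | ¬ p a} = {ω | ¬ p (prependSeq v ω)} from rfl, this, mul_zero]

/-- Almost surely all the transitions of the process have positive probability. -/
theorem ae_historyLaw_mem_support (q : List V → V → PMF V) (v : V) :
    ∀ᵐ ω ∂historyLaw q v, ∀ n : ℕ,
      ω (n + 1) ∈ (q (List.ofFn fun k : Fin n => ω k) (ω n)).support := by
  rw [ae_all_iff]
  intro n
  induction n generalizing q v with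
  | zero =>
    refine ae_historyLaw_of_forall ?_ fun w hw => ?_
    · exact (Set.to_countable {p : V × V | p.2 ∈ (q [] p.1).support}).measurableSet.preimage
        (f := fun ω : ℕ → V => (ω 0, ω 1)) (by fun_prop)
    · filter_upwards [ae_historyLaw_zero (fun l => q (v :: l)) w] with ω hω
      simpa [prependSeq, hω] using hw
  | succ n ih =>
    refine ae_historyLaw_of_forall ?_ fun w hw => ?_
    · have h2 : Measurable (fun (ω : ℕ → V) (k : Fin (n + 3)) => ω k) := by
        fun_prop
      exact h2 (Set.to_countable {x : Fin (n + 3) → V | x ⟨n + 2, by omega⟩ ∈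
        (q (List.ofFn fun k : Fin (n + 1) => x ⟨k, by omega⟩)
          (x ⟨n + 1, by omega⟩)).support}).measurableSet
    · filter_upwards [ih (fun l => q (v :: l)) w] with ω hω
      simpa [prependSeq, List.ofFn_succ] using hω

end HistoryProcess

namespace StochasticGame

/-! ### Moves, strategies and the combinatorics of fair paths. -/

section Moves

variable {V : Type*} [Fintype V] {G : StochasticGame V}

theorem step_player1 (σ₁ : G.Strategy1) (σ₂ : G.Strategy2) (h : List V) {v : V}
    (hv : G.kind v = VertexKind.player1) : step σ₁ σ₂ h v = σ₁.move h ⟨v, hv⟩ := by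
  unfold step
  split <;> first | rfl | (rename_i h'; cases hv.symm.trans h')

theorem step_player2 (σ₁ : G.Strategy1) (σ₂ : G.Strategy2) (h : List V) {v : V}
    (hv : G.kind v = VertexKind.player2) : step σ₁ σ₂ h v = σ₂.move h ⟨v, hv⟩ := by
  unfold step
  split <;> first | rfl | (rename_i h'; cases hv.symm.trans h')

theorem step_random (σ₁ : G.Strategy1) (σ₂ : G.Strategy2) (h : List V) {v : V}
    (hv : G.kind v = VertexKind.random) : step σ₁ σ₂ h v = G.randomStep v hv := by
  unfold step
  split <;> first | rfl | (rename_i h'; cases hv.symm.trans h')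

theorem randomStep_apply {v : V} (hv : G.kind v = VertexKind.random) (v' : V) :
    G.randomStep v hv v' = G.δ v v' := rfl

theorem support_step_subset (σ₁ : G.Strategy1) (σ₂ : G.Strategy2) (h : List V) (v : V) :
    (step σ₁ σ₂ h v).support ⊆ G.post v := by
  rcases hv : G.kind v
  · rw [step_player1 _ _ _ hv]; exact σ₁.support_subset h ⟨v, hv⟩
  · rw [step_player2 _ _ _ hv]; exact σ₂.support_subset h ⟨v, hv⟩
  · rw [step_random _ _ _ hv]
    intro v' hv'
    rw [PMF.mem_support_iff, randomStep_apply] at hv'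
    exact pos_iff_ne_zero.2 (by simpa using hv')

theorem step_apply_eq_zero (σ₁ : G.Strategy1) (σ₂ : G.Strategy2) (h : List V) {v v' : V}
    (hv : v' ∉ G.post v) : step σ₁ σ₂ h v v' = 0 := by
  by_contra hne
  exact hv (support_step_subset σ₁ σ₂ h v ((PMF.mem_support_iff _ _).2 hne))

theorem sum_step (σ₁ : G.Strategy1) (σ₂ : G.Strategy2) (h : List V) (v : V) :
    ∑ v', step σ₁ σ₂ h v v' = 1 := by
  rw [← tsum_fintype (L := .unconditional V), PMF.tsum_coe]

/-- The strategy that is left over of `σ` after the vertex `v` has been visited. -/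
def Strategy.tail {i : VertexKind} (σ : G.Strategy i) (v : V) : G.Strategy i where
  move h w := σ.move (v :: h) w
  support_subset h w := σ.support_subset (v :: h) w

theorem step_tail (σ₁ : G.Strategy1) (σ₂ : G.Strategy2) (v : V) (h : List V) (w : V) :
    step (σ₁.tail v) (σ₂.tail v) h w = step σ₁ σ₂ (v :: h) w := by
  rcases hw : G.kind w
  · rw [step_player1 _ _ _ hw, step_player1 _ _ _ hw]; rfl
  · rw [step_player2 _ _ _ hw, step_player2 _ _ _ hw]; rfl
  · rw [step_random _ _ _ hw, step_random _ _ _ hw]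

/-- The deterministic memoryless strategy that moves from `v` to `c v`. -/
noncomputable def Strategy.ofFun {i : VertexKind} (c : V → V)
    (hc : ∀ v, G.kind v = i → c v ∈ G.post v) : G.Strategy i where
  move _ v := PMF.pure (c v)
  support_subset _ v := by
    rw [PMF.support_pure, Set.singleton_subset_iff]
    exact hc v v.2

theorem Strategy.ofFun_move {i : VertexKind} (c : V → V)
    (hc : ∀ v, G.kind v = i → c v ∈ G.post v) (h : List V) (v : {v : V // G.kind v = i}) :
    (Strategy.ofFun c hc).move h v = PMF.pure (c v) := rfl

theorem Strategy.ofFun_tail {i : VertexKind} (c : V → V)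
    (hc : ∀ v, G.kind v = i → c v ∈ G.post v) (v : V) :
    (Strategy.ofFun c hc).tail v = Strategy.ofFun c hc := rfl

theorem Strategy.ofFun_deterministic {i : VertexKind} (c : V → V)
    (hc : ∀ v, G.kind v = i → c v ∈ G.post v) : (Strategy.ofFun c hc).Deterministic :=
  fun _ v => ⟨c v, rfl⟩

theorem Strategy.ofFun_memoryless {i : VertexKind} (c : V → V)
    (hc : ∀ v, G.kind v = i → c v ∈ G.post v) : (Strategy.ofFun c hc).Memoryless :=
  fun _ _ => rfl

theorem eq_of_mem_post_terminal {v v' : V} (hv : v ∈ G.terminal) (hv' : v' ∈ G.post v) :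
    v' = v := by
  by_contra hne
  have h0 : 0 < G.δ v v' := hv'
  rw [hv.2 v' hne] at h0
  exact lt_irrefl _ h0

theorem eq_of_mem_terminal_of_le {ω : ℕ → V} (hω : ω ∈ G.paths) {n : ℕ}
    (hn : ω n ∈ G.terminal) (m : ℕ) (hm : n ≤ m) : ω m = ω n := by
  induction m, hm using Nat.le_induction with
  | base => rfl
  | succ m _ ih => rw [← ih] at hn ⊢; exact eq_of_mem_post_terminal hn (hω m)

/-- After absorption only the terminal vertex recurs, and it is its own only successor. So almost
sure absorption implies fairness. -/
theorem mem_fairPaths_of_mem_terminal {ω : ℕ → V} (hω : ω ∈ G.paths) {n : ℕ}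
    (hn : ω n ∈ G.terminal) : ω ∈ G.fairPaths := by
  refine ⟨hω, fun v _ hfreq v' hv' => ?_⟩
  obtain ⟨m, hm, rfl⟩ := (Filter.frequently_atTop.1 hfreq) n
  rw [eq_of_mem_terminal_of_le hω hn m hm] at hv' hfreq
  rw [eq_of_mem_post_terminal hn hv']
  exact hfreq

theorem prependSeq_mem_fairPaths {v : V} {ω : ℕ → V} (hv : ω 0 ∈ G.post v)
    (hω : ω ∈ G.fairPaths) : prependSeq v ω ∈ G.fairPaths := by
  have hiff : ∀ w, (∃ᶠ n in Filter.atTop, prependSeq v ω n = w) ↔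
      ∃ᶠ n in Filter.atTop, ω n = w := fun w =>
    Filter.frequently_map (m := (· + 1)) (f := Filter.atTop) (P := fun n => prependSeq v ω n = w)
      |>.symm.trans (by rw [Filter.map_add_atTop_eq_nat]) |>.symm
  refine ⟨fun k => ?_, fun w hw hfreq w' hw' => ?_⟩
  · cases k with
    | zero => exact hv
    | succ k => exact hω.1 k
  · rw [hiff] at hfreq ⊢
    exact hω.2 w hw hfreq w' hw'

theorem exists_seq_frequently_eq (v : V) :
    ∃ e : ℕ → V, (∀ k, e k ∈ G.post v) ∧
      ∀ v' ∈ G.post v, ∃ᶠ k in Filter.atTop, e k = v' := by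
  have := Finite.to_countable (α := V)
  obtain ⟨s, hs⟩ := (Set.to_countable (G.post v)).exists_eq_range (G.exists_succ v)
  refine ⟨fun k => s k.unpair.1, fun k => hs ▸ Set.mem_range_self _, fun v' hv' => ?_⟩
  obtain ⟨j, rfl⟩ : v' ∈ Set.range s := hs ▸ hv'
  exact Filter.frequently_atTop.2 fun a => ⟨Nat.pair j a, Nat.right_le_pair _ _, by simp⟩

open Classical in
theorem _root_.List.count_ofFn_eq_natCount {V : Type*} (ω : ℕ → V) (v : V) (n : ℕ) :
    (List.ofFn fun k : Fin n => ω k).count v = Nat.count (fun k => ω k = v) n := by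
  induction n with
  | zero => simp
  | succ n ih =>
    rw [List.ofFn_succ', List.concat_eq_append, List.count_append, Nat.count_succ]
    simp only [Fin.val_castSucc, Fin.val_last, ih, List.count_singleton, beq_iff_eq]

end Moves

/-! ### The law of a play, measurability, and existence of a fair strategy. -/

section Plays

variable {V : Type*} [Fintype V] {G : StochasticGame V} [MeasurableSpace V]
  [DiscreteMeasurableSpace V]

theorem prob_eq_historyLaw (σ₁ : G.Strategy1) (σ₂ : G.Strategy2) (v : V) :
    prob σ₁ σ₂ v = historyLaw (step σ₁ σ₂) v := rfl

instance isProbabilityMeasure_prob (σ₁ : G.Strategy1) (σ₂ : G.Strategy2) (v : V) :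
    IsProbabilityMeasure (prob σ₁ σ₂ v) := isProbabilityMeasure_historyLaw _ _

theorem prob_tail (σ₁ : G.Strategy1) (σ₂ : G.Strategy2) (v w : V) :
    prob (σ₁.tail v) (σ₂.tail v) w = historyLaw (fun h => step σ₁ σ₂ (v :: h)) w := by
  rw [prob_eq_historyLaw]
  refine congrArg (fun q => historyLaw q w) ?_
  funext h w
  exact step_tail σ₁ σ₂ v h w

theorem lintegral_prob (σ₁ : G.Strategy1) (σ₂ : G.Strategy2) (v : V) {F : (ℕ → V) → ℝ≥0∞}
    (hF : Measurable F) :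
    ∫⁻ ω, F ω ∂prob σ₁ σ₂ v = ∑ w, step σ₁ σ₂ [] v w *
      ∫⁻ ω, F (prependSeq v ω) ∂prob (σ₁.tail v) (σ₂.tail v) w := by
  simp only [prob_tail]
  exact lintegral_historyLaw _ _ hF

theorem ae_prob_zero (σ₁ : G.Strategy1) (σ₂ : G.Strategy2) (v : V) :
    ∀ᵐ ω ∂prob σ₁ σ₂ v, ω 0 = v := ae_historyLaw_zero _ _

theorem ae_prob_mem_paths (σ₁ : G.Strategy1) (σ₂ : G.Strategy2) (v : V) :
    ∀ᵐ ω ∂prob σ₁ σ₂ v, ω ∈ G.paths := by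
  filter_upwards [ae_historyLaw_mem_support (step σ₁ σ₂) v] with ω hω k
  exact support_step_subset _ _ _ _ (hω k)

theorem measurableSet_paths : MeasurableSet G.paths := by
  have : G.paths = ⋂ k, (fun ω : ℕ → V => (ω k, ω (k + 1))) ⁻¹' {p | 0 < G.δ p.1 p.2} := by
    ext ω; simp [paths]
  rw [this]
  exact MeasurableSet.iInter fun k => (Set.to_countable _).measurableSet.preimage (by fun_prop)

theorem measurableSet_frequently_eq (v : V) :
    MeasurableSet {ω : ℕ → V | ∃ᶠ n in Filter.atTop, ω n = v} := by
  have : {ω : ℕ → V | ∃ᶠ n in Filter.atTop, ω n = v} =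
      ⋂ a, ⋃ n, ⋃ _ : a ≤ n, (fun ω : ℕ → V => ω n) ⁻¹' {v} := by
    ext ω; simp [Filter.frequently_atTop]
  rw [this]
  exact MeasurableSet.iInter fun a => MeasurableSet.iUnion fun n => MeasurableSet.iUnion fun _ =>
    measurable_pi_apply n (measurableSet_singleton v)

theorem measurableSet_fairPaths : MeasurableSet G.fairPaths := by
  have : G.fairPaths = G.paths ∩ ⋂ v, ⋂ _ : G.kind v = VertexKind.player2,
      ({ω : ℕ → V | ∃ᶠ n in Filter.atTop, ω n = v}ᶜ ∪
        ⋂ v', ⋂ _ : v' ∈ G.post v, {ω : ℕ → V | ∃ᶠ n in Filter.atTop, ω n = v'}) := by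
    ext ω
    simp only [fairPaths, Set.mem_ofPred_eq, Set.mem_inter_iff, Set.mem_iInter, Set.mem_union,
      Set.mem_compl_iff, imp_iff_not_or]
  rw [this]
  have := Finite.to_countable (α := V)
  refine measurableSet_paths.inter (MeasurableSet.iInter fun v => MeasurableSet.iInter fun _ => ?_)
  exact (measurableSet_frequently_eq v).compl.union
    (MeasurableSet.iInter fun v' => MeasurableSet.iInter fun _ => measurableSet_frequently_eq v')

theorem measurableSet_reachTerminal : MeasurableSet G.reachTerminal := by
  have : G.reachTerminal = G.paths ∩ ⋃ n, (fun ω : ℕ → V => ω n) ⁻¹' G.terminal := by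
    ext ω; simp [reachTerminal]
  rw [this]
  exact measurableSet_paths.inter (MeasurableSet.iUnion fun n =>
    (Set.to_countable _).measurableSet.preimage (measurable_pi_apply n))

theorem mem_fairStrategies_iff {σ₂ : G.Strategy2} :
    σ₂ ∈ G.fairStrategies ↔
      ∀ (σ₁ : G.Strategy1) (v : V), ∀ᵐ ω ∂prob σ₁ σ₂ v, ω ∈ G.fairPaths :=
  forall₂_congr fun _ _ => (mem_ae_iff_prob_eq_one measurableSet_fairPaths).symm

theorem StoppingUnderFairness.ae_mem_terminal (hG : G.StoppingUnderFairness) (σ₁ : G.Strategy1)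
    {σ₂ : G.Strategy2} (hσ₂ : σ₂ ∈ G.fairStrategies) (v : V) :
    ∀ᵐ ω ∂prob σ₁ σ₂ v, ∃ n, ω n ∈ G.terminal := by
  filter_upwards [(mem_ae_iff_prob_eq_one measurableSet_reachTerminal).2 (hG σ₁ σ₂ hσ₂ v)]
    with ω hω using hω.2

variable (G) in
open Classical in
/-- Player 2 has a fair strategy: at each vertex cycle through the successors. -/
theorem nonempty_fairStrategies : G.fairStrategies.Nonempty := by
  choose e he he' using G.exists_seq_frequently_eq
  refine ⟨⟨fun h v => PMF.pure (e v (h.count v.1)), fun h v => ?_⟩, ?_⟩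
  · rw [PMF.support_pure, Set.singleton_subset_iff]
    exact he _ _
  rw [mem_fairStrategies_iff]
  intro σ₁ v
  filter_upwards [ae_prob_mem_paths σ₁ _ v, ae_historyLaw_mem_support (step σ₁ _) v] with ω hω hsupp
  refine ⟨hω, fun w hw hfreq w' hw' => Filter.frequently_atTop.2 fun a => ?_⟩
  -- The history passed to a strategy omits the current vertex, so at visit number `k` to `w`
  -- (counted from `0`) the count is exactly `k` and the move is `e w k`. Some `k ≥ a` has `e w k =
  -- w'`, and visit `k` happens no earlier than time `k`.
  obtain ⟨k, hk, hek⟩ := Filter.frequently_atTop.1 (he' w w' hw') a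
  have hinf : {n | ω n = w}.Infinite := Nat.frequently_atTop_iff_infinite.1 hfreq
  have hn : ω (Nat.nth (fun n => ω n = w) k) = w := Nat.nth_mem_of_infinite hinf k
  refine ⟨Nat.nth (fun n => ω n = w) k + 1, ?_, ?_⟩
  · have := (Nat.nth_strictMono hinf).le_apply (x := k)
    omega
  · have := hsupp (Nat.nth (fun n => ω n = w) k)
    rw [step_player2 _ _ _ (by rw [hn]; exact hw), PMF.support_pure, Set.mem_singleton_iff,
      List.count_ofFn_eq_natCount] at this
    rw [this]
    simp only [hn]
    rw [Nat.count_nth_of_infinite hinf, hek]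

end Plays

end StochasticGame

namespace StochasticGame

/-! ### The attractor of the terminal set and its rank. -/

section Attractor

variable {V : Type*} [Fintype V] (G : StochasticGame V)

/-- The vertices from which Player 2 can reach a terminal vertex with positive probability within
`n` steps, whatever Player 1 does. -/
def attractor : ℕ → Set V
  | 0 => G.terminal
  | n + 1 => {v | v ∈ attractor n ∨
      (G.kind v = VertexKind.player1 ∧ G.post v ⊆ attractor n) ∨
      (G.kind v ≠ VertexKind.player1 ∧ ∃ v' ∈ G.post v, v' ∈ attractor n)}

theorem attractor_mono : Monotone G.attractor :=
  monotone_nat_of_le_succ fun _ _ h => Or.inl h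

variable {G}

theorem exists_mem_post_forall_notMem_attractor {v : V} (hk : G.kind v = VertexKind.player1)
    (hv : ∀ n, v ∉ G.attractor n) : ∃ v' ∈ G.post v, ∀ n, v' ∉ G.attractor n := by
  by_contra! hcon
  choose! m hm using hcon
  -- Finiteness of `V` gives one stage containing all successors.
  refine hv (Finset.univ.sup m + 1) (Or.inr (Or.inl ⟨hk, fun v' hv' => ?_⟩))
  exact G.attractor_mono (Finset.le_sup (Finset.mem_univ v')) (hm v' hv')

variable [MeasurableSpace V] [DiscreteMeasurableSpace V]

/-- From outside all stages, Player 1 can always choose a successor outside, while moves of Player 2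
and of chance cannot enter any stage. The play would then avoid the terminal set even against a fair
strategy. One exists by `nonempty_fairStrategies`, without which the stopping hypothesis would be
void. -/
theorem StoppingUnderFairness.exists_mem_attractor (hG : G.StoppingUnderFairness) (v : V) :
    ∃ n, v ∈ G.attractor n := by
  by_contra! hv
  have hc : ∀ v, ∃ v' ∈ G.post v, G.kind v = VertexKind.player1 →
      (∀ n, v ∉ G.attractor n) → ∀ n, v' ∉ G.attractor n := by
    intro v
    by_cases h : G.kind v = VertexKind.player1 ∧ ∀ n, v ∉ G.attractor n
    · obtain ⟨v', hv', hn⟩ := exists_mem_post_forall_notMem_attractor h.1 h.2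
      exact ⟨v', hv', fun _ _ => hn⟩
    · obtain ⟨v', hv'⟩ := G.exists_succ v
      exact ⟨v', hv', fun h1 h2 => absurd ⟨h1, h2⟩ h⟩
  choose c hc hc' using hc
  obtain ⟨σ₂, hσ₂⟩ := G.nonempty_fairStrategies
  let σ₁ : G.Strategy1 := Strategy.ofFun c fun v _ => hc v
  have hae : ∀ᵐ ω ∂prob σ₁ σ₂ v, False := by
    filter_upwards [hG.ae_mem_terminal σ₁ hσ₂ v, ae_prob_zero σ₁ σ₂ v,
      ae_historyLaw_mem_support (step σ₁ σ₂) v] with ω ⟨n, hn⟩ h0 hsupp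
    suffices h : ∀ m k, ω m ∉ G.attractor k from h n 0 hn
    intro m
    induction m with
    | zero => rw [h0]; exact hv
    | succ m ih =>
      have hm := hsupp m
      by_cases hk : G.kind (ω m) = VertexKind.player1
      · rw [step_player1 _ _ _ hk, Strategy.ofFun_move, PMF.support_pure,
          Set.mem_singleton_iff] at hm
        rw [hm]
        exact hc' _ hk ih
      · intro k hmem
        exact ih (k + 1) (Or.inr (Or.inr ⟨hk, _, support_step_subset _ _ _ _ hm, hmem⟩))
  simp [Filter.eventually_false_iff_eq_bot, NeZero.ne] at hae

/-- The rank is the first attractor stage containing the vertex; the rule by which a nonterminal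
vertex enters that stage supplies the lower-ranked successors. -/
theorem StoppingUnderFairness.exists_rank (hG : G.StoppingUnderFairness) :
    ∃ rk : V → ℕ, ∀ v ∉ G.terminal,
      (G.kind v = VertexKind.player1 → ∀ v' ∈ G.post v, rk v' < rk v) ∧
      (G.kind v ≠ VertexKind.player1 → ∃ v' ∈ G.post v, rk v' < rk v) := by
  classical
  refine ⟨fun v => Nat.find (hG.exists_mem_attractor v), fun v hv => ?_⟩
  have hspec := Nat.find_spec (hG.exists_mem_attractor v)
  have hmin : ∀ m < Nat.find (hG.exists_mem_attractor v), v ∉ G.attractor m :=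
    fun m hm => Nat.find_min (hG.exists_mem_attractor v) hm
  rcases hn : Nat.find (hG.exists_mem_attractor v) with _ | n
  · rw [hn] at hspec; exact absurd hspec hv
  · rw [hn] at hspec hmin
    simp only [hn]
    have hlt : ∀ v' ∈ G.attractor n, Nat.find (hG.exists_mem_attractor v') < n + 1 :=
      fun v' hv' => Nat.lt_succ_of_le (Nat.find_min' _ hv')
    rcases hspec with h | h | h
    · exact absurd h (hmin n n.lt_succ_self)
    · exact ⟨fun _ v' hv' => hlt v' (h.2 hv'), fun hk => absurd h.1 hk⟩
    · obtain ⟨hk, v', hv', hmem⟩ := h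
      exact ⟨fun hk' => absurd hk' hk, fun _ => ⟨v', hv', hlt v' hmem⟩⟩

end Attractor

/-- A potential that decreases by `R` on average at each step that lowers the rank with
probability at least `p`. -/
theorem exists_potential {V : Type*} [Fintype V] (rk : V → ℕ) {p : ℝ} (hp : 0 < p) (hp1 : p ≤ 1)
    {R : ℝ} (hR : 0 ≤ R) :
    ∃ g : V → ℝ≥0, ∀ (v : V) (q : V → ℝ), (∀ w, 0 ≤ q w) → ∑ w, q w = 1 →
      p ≤ ∑ w with rk w < rk v, q w → R + ∑ w, q w * g w ≤ g v := by
  -- The recursion makes a gain of one level, even with probability only `p`, pay for `R` and for a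
  -- complete loss of `d j` otherwise.
  obtain ⟨d, hd, hd0⟩ : ∃ d : ℕ → ℝ, (∀ j, p * d (j + 1) = d j + R) ∧ ∀ j, 0 ≤ d j := by
    refine ⟨fun j => Nat.rec 0 (fun _ x => (x + R) / p) j, fun j => mul_div_cancel₀ _ hp.ne',
      fun j => ?_⟩
    induction j with
    | zero => exact le_rfl
    | succ j ih => exact div_nonneg (add_nonneg ih hR) hp.le
  have hmono : Monotone d := monotone_nat_of_le_succ fun j => by
    nlinarith [hd j, hd0 (j + 1)]
  let N := Finset.univ.sup rk
  have hN : ∀ v, rk v ≤ N := fun v => Finset.le_sup (Finset.mem_univ v)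
  -- Reversing the rank turns lower ranks into larger values of `d`, and subtracting from `d N`
  -- keeps `g` nonnegative.
  obtain ⟨g, hg⟩ : ∃ g : V → ℝ≥0, ∀ v, (g v : ℝ) = d N - d (N - rk v) :=
    ⟨fun v => ⟨d N - d (N - rk v), sub_nonneg.2 (hmono (Nat.sub_le _ _))⟩, fun _ => rfl⟩
  refine ⟨g, fun v q hq hsum hpq => ?_⟩
  simp only [hg]
  have hpos : 0 < rk v := by
    by_contra h
    have : rk v = 0 := by omega
    simp only [this, not_lt_zero, Finset.filter_false, Finset.sum_empty] at hpq
    linarith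
  have h1 : ∑ w, q w * (d N - d (N - rk w)) = d N - ∑ w, q w * d (N - rk w) := by
    simp only [mul_sub, Finset.sum_sub_distrib, ← Finset.sum_mul, hsum, one_mul]
  have h2 : p * d (N - rk v + 1) ≤ ∑ w, q w * d (N - rk w) := by
    calc p * d (N - rk v + 1) ≤ (∑ w with rk w < rk v, q w) * d (N - rk v + 1) :=
          mul_le_mul_of_nonneg_right hpq (hd0 _)
      _ = ∑ w with rk w < rk v, q w * d (N - rk v + 1) := Finset.sum_mul _ _ _
      _ ≤ ∑ w with rk w < rk v, q w * d (N - rk w) := by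
          refine Finset.sum_le_sum fun w hw => mul_le_mul_of_nonneg_left (hmono ?_) (hq w)
          have := (Finset.mem_filter.1 hw).2
          have := hN v
          omega
      _ ≤ ∑ w, q w * d (N - rk w) :=
          Finset.sum_le_sum_of_subset_of_nonneg (Finset.filter_subset _ _)
            fun w _ _ => mul_nonneg (hq w) (hd0 _)
  rw [h1]
  linarith [hd (N - rk v)]

theorem measurable_comp_eval {V β : Type*} [MeasurableSpace V] [DiscreteMeasurableSpace V]
    [MeasurableSpace β] (c : V → β) (n : ℕ) :
    Measurable fun ω : ℕ → V => c (ω n) :=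
  (Measurable.of_discrete (f := c)).comp (measurable_pi_apply n)

theorem sum_range_succ_prependSeq {V : Type*} (c : V → ℝ≥0∞) (v : V) (ω : ℕ → V) (n : ℕ) :
    ∑ k ∈ Finset.range (n + 1), c (prependSeq v ω k) =
      c v + ∑ k ∈ Finset.range n, c (ω k) := by
  rw [Finset.sum_range_succ', add_comm]
  rfl

theorem exists_pos_le_δ {V : Type*} [Fintype V] (G : StochasticGame V) :
    ∃ p : ℝ≥0, 0 < p ∧ p ≤ 1 ∧ ∀ v, ∀ v' ∈ G.post v, p ≤ G.δ v v' := by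
  classical
  obtain ⟨p, hp, h⟩ : ∃ p : ℝ≥0, 0 < p ∧ ∀ x : V × V, 0 < G.δ x.1 x.2 → p ≤ G.δ x.1 x.2 := by
    rcases isEmpty_or_nonempty V with hV | ⟨⟨v₀⟩⟩
    · exact ⟨1, one_pos, fun x => hV.elim x.1⟩
    · obtain ⟨v₁, h₁⟩ := G.exists_succ v₀
      obtain ⟨x, hx, hmin⟩ := Set.exists_min_image {x : V × V | 0 < G.δ x.1 x.2}
        (fun x => G.δ x.1 x.2) (Set.toFinite _) ⟨(v₀, v₁), h₁⟩
      exact ⟨_, hx, fun y hy => hmin y hy⟩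
  exact ⟨min p 1, lt_min hp one_pos, min_le_right _ _,
    fun v v' hv' => (min_le_left _ _).trans (h (v, v') hv')⟩

/-! ### Bounded expected absorption time under a memoryless strategy of Player 2. -/

section Potential

variable {V : Type*} [Fintype V] {G : StochasticGame V} [MeasurableSpace V]
  [DiscreteMeasurableSpace V]

/-- If `g` bounds the cost of one step plus its own mean after the step, then it bounds the
expected total cost. -/
theorem lintegral_tsum_le_of_potential {σ₂ : G.Strategy2} (htail : ∀ v, σ₂.tail v = σ₂)
    {c g : V → ℝ≥0∞}
    (h : ∀ (σ₁ : G.Strategy1) (v : V), c v + ∑ w, step σ₁ σ₂ [] v w * g w ≤ g v)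
    (σ₁ : G.Strategy1) (v : V) : ∫⁻ ω, ∑' n, c (ω n) ∂prob σ₁ σ₂ v ≤ g v := by
  -- The induction ranges over all `σ₁`, since the first step replaces `σ₁` by its tail while `σ₂`
  -- is its own tail.
  have key : ∀ (n : ℕ) (σ₁ : G.Strategy1) (v : V),
      ∫⁻ ω, ∑ k ∈ Finset.range n, c (ω k) ∂prob σ₁ σ₂ v ≤ g v := by
    intro n
    induction n with
    | zero => intro σ₁ v; simp
    | succ n ih =>
      intro σ₁ v
      rw [lintegral_prob _ _ _ (Finset.measurable_fun_sum _ fun k _ => measurable_comp_eval c k)]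
      simp only [sum_range_succ_prependSeq, htail]
      refine le_trans ?_ (h σ₁ v)
      calc ∑ w, step σ₁ σ₂ [] v w *
            ∫⁻ ω, (c v + ∑ k ∈ Finset.range n, c (ω k)) ∂prob (σ₁.tail v) σ₂ w
          ≤ ∑ w, step σ₁ σ₂ [] v w * (c v + g w) := by
            refine Finset.sum_le_sum fun w _ => mul_le_mul_right ?_ _
            rw [lintegral_add_left measurable_const, lintegral_const, measure_univ, mul_one]
            exact add_le_add_right (ih _ _) _
        _ = c v + ∑ w, step σ₁ σ₂ [] v w * g w := by
            simp only [mul_add, Finset.sum_add_distrib, ← Finset.sum_mul, sum_step, one_mul]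
  rw [lintegral_tsum fun n => (measurable_comp_eval c n).aemeasurable]
  refine ENNReal.tsum_le_of_sum_range_le fun n => ?_
  rw [← lintegral_finsetSum _ fun k _ => measurable_comp_eval c k]
  exact key n σ₁ v

open Classical in
/-- In a game that is stopping under fairness, Player 2 has a deterministic memoryless fair
strategy against which the expected number of steps to a terminal vertex is bounded. -/
theorem StoppingUnderFairness.exists_detMemorylessFair2 (hG : G.StoppingUnderFairness)
    {R : ℝ≥0} (hR : 0 < R) :
    ∃ σ₂ ∈ G.detMemorylessFair2, ∃ g : V → ℝ≥0, ∀ (σ₁ : G.Strategy1) (v : V),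
      ∫⁻ ω, ∑' n, (if ω n ∈ G.terminal then 0 else (R : ℝ≥0∞)) ∂prob σ₁ σ₂ v ≤ g v := by
  obtain ⟨rk, hrk⟩ := hG.exists_rank
  obtain ⟨p, hp, hp1, hpδ⟩ := G.exists_pos_le_δ
  obtain ⟨g, hg⟩ := exists_potential rk (p := p) (R := R) (by exact_mod_cast hp)
    (by exact_mod_cast hp1) R.2
  -- `c` is also specified at chance vertices: there `c v` is not a move but the successor whose
  -- probability, at least `p`, witnesses the rank decrease.
  have hc : ∀ v, ∃ v' ∈ G.post v, G.kind v ≠ VertexKind.player1 → v ∉ G.terminal →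
      rk v' < rk v := by
    intro v
    by_cases h : G.kind v ≠ VertexKind.player1 ∧ v ∉ G.terminal
    · obtain ⟨v', hv', hlt⟩ := (hrk v h.2).2 h.1
      exact ⟨v', hv', fun _ _ => hlt⟩
    · obtain ⟨v', hv'⟩ := G.exists_succ v
      exact ⟨v', hv', fun h1 h2 => absurd ⟨h1, h2⟩ h⟩
  choose c hc hc' using hc
  let σ₂ : G.Strategy2 := Strategy.ofFun c fun v _ => hc v
  have hdecr : ∀ (σ₁ : G.Strategy1) (v : V), v ∉ G.terminal →
      (p : ℝ≥0∞) ≤ ∑ w with rk w < rk v, step σ₁ σ₂ [] v w := by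
    intro σ₁ v hv
    rcases hk : G.kind v
    · have : ∑ w with rk w < rk v, step σ₁ σ₂ [] v w = ∑ w, step σ₁ σ₂ [] v w := by
        refine Finset.sum_subset (Finset.filter_subset _ _) fun w _ hw => ?_
        refine step_apply_eq_zero _ _ _ fun hpost => hw ?_
        exact Finset.mem_filter.2 ⟨Finset.mem_univ _, (hrk v hv).1 hk w hpost⟩
      rw [this, sum_step]
      exact_mod_cast hp1
    · have hne : G.kind v ≠ VertexKind.player1 := by rw [hk]; exact fun h => nomatch h
      refine le_trans ?_ (Finset.single_le_sum (f := fun w => step σ₁ σ₂ [] v w)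
        (fun _ _ => zero_le) (Finset.mem_filter.2 ⟨Finset.mem_univ (c v), hc' v hne hv⟩))
      rw [step_player2 _ _ _ hk, Strategy.ofFun_move, PMF.pure_apply_self]
      exact_mod_cast hp1
    · have hne : G.kind v ≠ VertexKind.player1 := by rw [hk]; exact fun h => nomatch h
      refine le_trans ?_ (Finset.single_le_sum (f := fun w => step σ₁ σ₂ [] v w)
        (fun _ _ => zero_le) (Finset.mem_filter.2 ⟨Finset.mem_univ (c v), hc' v hne hv⟩))
      rw [step_random _ _ _ hk, randomStep_apply]
      exact_mod_cast hpδ v (c v) (hc v)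
  have hint : ∀ (σ₁ : G.Strategy1) (v : V),
      ∫⁻ ω, ∑' n, (if ω n ∈ G.terminal then 0 else (R : ℝ≥0∞)) ∂prob σ₁ σ₂ v ≤ g v := by
    refine lintegral_tsum_le_of_potential (c := fun v => if v ∈ G.terminal then 0 else (R : ℝ≥0∞))
      (g := fun v => (g v : ℝ≥0∞)) (fun _ => rfl) fun σ₁ v => ?_
    by_cases hv : v ∈ G.terminal
    · rw [if_pos hv, zero_add, Finset.sum_eq_single v]
      · exact mul_le_of_le_one_left zero_le (PMF.coe_le_one _ _)
      · intro w _ hw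
        rw [step_apply_eq_zero _ _ _ fun h => hw (eq_of_mem_post_terminal hv h), zero_mul]
      · simp
    · rw [if_neg hv]
      have hq : ∀ w, step σ₁ σ₂ [] v w = ((step σ₁ σ₂ [] v w).toNNReal : ℝ≥0∞) :=
        fun w => (ENNReal.coe_toNNReal (PMF.apply_ne_top _ _)).symm
      have h1 := sum_step σ₁ σ₂ [] v
      have h2 := hdecr σ₁ v hv
      generalize hq' : (fun w => (step σ₁ σ₂ [] v w).toNNReal) = q at *
      have hq'' : ∀ w, step σ₁ σ₂ [] v w = (q w : ℝ≥0∞) := fun w => by rw [hq, ← hq']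
      simp only [hq''] at h1 h2 ⊢
      have := hg v (fun w => (q w : ℝ)) (fun w => (q w).2) (by exact_mod_cast h1)
        (by exact_mod_cast h2)
      exact_mod_cast this
  refine ⟨σ₂, ⟨Strategy.ofFun_deterministic _ _, Strategy.ofFun_memoryless _ _, ?_⟩, g, hint⟩
  rw [mem_fairStrategies_iff]
  intro σ₁ v
  have hmeas : Measurable fun ω : ℕ → V =>
      ∑' n, (if ω n ∈ G.terminal then 0 else (R : ℝ≥0∞)) :=
    Measurable.tsum fun n =>
      measurable_comp_eval (fun v => if v ∈ G.terminal then 0 else (R : ℝ≥0∞)) n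
  filter_upwards [ae_prob_mem_paths σ₁ σ₂ v,
    ae_lt_top hmeas (ne_top_of_le_ne_top ENNReal.coe_ne_top (hint σ₁ v))] with ω hω hlt
  -- An unfair path never meets a terminal vertex, hence pays `R > 0` forever, contradicting the
  -- almost sure finiteness of the total cost.
  by_contra hfair
  have hnever : ∀ n, ω n ∉ G.terminal := fun n hn =>
    hfair (mem_fairPaths_of_mem_terminal hω hn)
  simp only [hnever, if_false] at hlt
  rw [ENNReal.tsum_const_eq_top_of_ne_zero (by exact_mod_cast hR.ne')] at hlt
  exact lt_irrefl _ hlt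

end Potential

end StochasticGame

/-! ### Changing the first move of a family of strategies of Player 2. -/

namespace StochasticGame

variable {V : Type*} [Fintype V] {G : StochasticGame V}

/-- The strategy that makes its first move according to `c`, and then plays as `τ w` as if the
game had started in the second vertex `w`. -/
noncomputable def Strategy.consFamily {i : VertexKind} (c : V → V)
    (hc : ∀ v, G.kind v = i → c v ∈ G.post v) (τ : V → G.Strategy i) : G.Strategy i where
  move
    | [], v => PMF.pure (c v)
    | _ :: h, v => (τ ((h ++ [v.1]).head (by simp))).move h v
  support_subset h v := by
    cases h with
    | nil =>
      rw [PMF.support_pure, Set.singleton_subset_iff]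
      exact hc v v.2
    | cons a h => exact (τ _).support_subset h v

variable [MeasurableSpace V] [DiscreteMeasurableSpace V]

theorem prob_consFamily_tail (c : V → V)
    (hc : ∀ v, G.kind v = VertexKind.player2 → c v ∈ G.post v) (τ : V → G.Strategy2)
    (σ₁ : G.Strategy1) (v w : V) :
    prob σ₁ ((Strategy.consFamily c hc τ).tail v) w = prob σ₁ (τ w) w := by
  refine historyLaw_congr fun l u hl => ?_
  have hhead : (l ++ [u]).head (by simp) = w := by
    rw [List.head?_eq_some_head (by simp)] at hl
    exact Option.some.inj hl
  rcases hu : G.kind u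
  · rw [step_player1 _ _ _ hu, step_player1 _ _ _ hu]
  · rw [step_player2 _ _ _ hu, step_player2 _ _ _ hu]
    change (τ ((l ++ [u]).head _)).move l ⟨u, hu⟩ = _
    rw [hhead]
  · rw [step_random _ _ _ hu, step_random _ _ _ hu]

/-- Fairness concerns only what recurs, so one legal move put in front of plays that are almost
surely fair does not affect it. -/
theorem consFamily_mem_fairStrategies (c : V → V)
    (hc : ∀ v, G.kind v = VertexKind.player2 → c v ∈ G.post v) {τ : V → G.Strategy2}
    (hτ : ∀ w, τ w ∈ G.fairStrategies) : Strategy.consFamily c hc τ ∈ G.fairStrategies := by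
  rw [mem_fairStrategies_iff]
  intro σ₁ v
  refine ae_historyLaw_of_forall (p := fun ω => ω ∈ G.fairPaths) measurableSet_fairPaths
    fun w hw => ?_
  rw [← prob_tail, prob_consFamily_tail]
  filter_upwards [mem_fairStrategies_iff.1 (hτ w) (σ₁.tail v) w, ae_prob_zero (σ₁.tail v) (τ w) w]
    with ω hω h0
  exact prependSeq_mem_fairPaths (h0 ▸ support_step_subset _ _ _ _ hw) hω

end StochasticGame

namespace RewardGame

open StochasticGame

/-! ### The Bellman functional and one-step optimal moves. -/

section Bellman

variable {V : Type*} [Fintype V] {G : RewardGame V}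

theorem rew_prependSeq (v : V) (ω : ℕ → V) : G.rew (prependSeq v ω) = G.r v + G.rew ω := by
  rw [rew, rew, tsum_eq_zero_add' ENNReal.summable]
  simp only [prependSeq]

theorem bellman_terminal (f : V → ℝ≥0∞) {v : V} (hv : v ∈ G.terminal) : G.bellman f v = 0 :=
  if_pos hv

theorem bellman_player1 (f : V → ℝ≥0∞) {v : V} (hv : v ∉ G.terminal)
    (hk : G.kind v = VertexKind.player1) :
    G.bellman f v = ⨆ v' ∈ G.post v, ((G.r v : ℝ≥0∞) + f v') := by
  rw [bellman, if_neg hv, hk]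

theorem bellman_player2 (f : V → ℝ≥0∞) {v : V} (hv : v ∉ G.terminal)
    (hk : G.kind v = VertexKind.player2) :
    G.bellman f v = ⨅ v' ∈ G.post v, ((G.r v : ℝ≥0∞) + f v') := by
  rw [bellman, if_neg hv, hk]

theorem bellman_random (f : V → ℝ≥0∞) {v : V} (hv : v ∉ G.terminal)
    (hk : G.kind v = VertexKind.random) :
    G.bellman f v = (G.r v : ℝ≥0∞) + ∑ v', (G.δ v v' : ℝ≥0∞) * f v' := by
  rw [bellman, if_neg hv, hk]

theorem bellman_mono : Monotone G.bellman := by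
  intro f g hfg v
  by_cases hv : v ∈ G.terminal
  · rw [bellman_terminal f hv, bellman_terminal g hv]
  rcases hk : G.kind v
  · rw [bellman_player1 f hv hk, bellman_player1 g hv hk]
    exact iSup₂_mono fun v' _ => add_le_add_right (hfg v') _
  · rw [bellman_player2 f hv hk, bellman_player2 g hv hk]
    exact iInf₂_mono fun v' _ => add_le_add_right (hfg v') _
  · rw [bellman_random f hv hk, bellman_random g hv hk]
    exact add_le_add_right (Finset.sum_le_sum fun v' _ => mul_le_mul_right (hfg v') _) _

theorem bellman_ne_top {f : V → ℝ≥0∞} (hf : ∀ v, f v ≠ ⊤) (v : V) : G.bellman f v ≠ ⊤ := by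
  by_cases hv : v ∈ G.terminal
  · rw [bellman_terminal f hv]; exact ENNReal.zero_ne_top
  rcases hk : G.kind v
  · rw [bellman_player1 f hv hk]
    refine ne_top_of_le_ne_top (b := (G.r v : ℝ≥0∞) + ∑ w, f w)
      (ENNReal.add_ne_top.2 ⟨ENNReal.coe_ne_top, ENNReal.sum_ne_top.2 fun w _ => hf w⟩) ?_
    exact iSup₂_le fun v' _ => add_le_add_right
      (Finset.single_le_sum (fun _ _ => zero_le) (Finset.mem_univ v')) _
  · rw [bellman_player2 f hv hk]
    obtain ⟨v', hv'⟩ := G.exists_succ v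
    exact ne_top_of_le_ne_top (ENNReal.add_ne_top.2 ⟨ENNReal.coe_ne_top, hf v'⟩)
      (iInf₂_le v' hv')
  · rw [bellman_random f hv hk]
    exact ENNReal.add_ne_top.2 ⟨ENNReal.coe_ne_top, ENNReal.sum_ne_top.2 fun w _ =>
      ENNReal.mul_ne_top ENNReal.coe_ne_top (hf w)⟩

theorem exists_argmax (G : RewardGame V) (f : V → ℝ≥0∞) :
    ∃ c : V → V, ∀ v, c v ∈ G.post v ∧ ∀ w ∈ G.post v, f w ≤ f (c v) := by
  choose c hc using fun v => Set.exists_max_image (G.post v) f (Set.toFinite _) (G.exists_succ v)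
  exact ⟨c, hc⟩

theorem exists_argmin (G : RewardGame V) (f : V → ℝ≥0∞) :
    ∃ c : V → V, ∀ v, c v ∈ G.post v ∧ ∀ w ∈ G.post v, f (c v) ≤ f w := by
  choose c hc using fun v => Set.exists_min_image (G.post v) f (Set.toFinite _) (G.exists_succ v)
  exact ⟨c, hc⟩

theorem sum_pure_mul (c : V) (f : V → ℝ≥0∞) : ∑ w, PMF.pure c w * f w = f c := by
  classical
  simp [PMF.pure_apply]

/-- A Player 1 that maximizes `f` makes the mean of `f` after one step at least what the Bellman
functional says. -/
theorem bellman_le_step {f : V → ℝ≥0∞} {c : V → V}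
    (hc : ∀ v, c v ∈ G.post v ∧ ∀ w ∈ G.post v, f w ≤ f (c v)) (σ₂ : G.Strategy2) (h : List V)
    (v : V) :
    G.bellman f v ≤ G.r v +
      ∑ w, step (Strategy.ofFun c fun v _ => (hc v).1 : G.Strategy1) σ₂ h v w * f w := by
  by_cases hv : v ∈ G.terminal
  · rw [bellman_terminal f hv]; exact zero_le
  rcases hk : G.kind v
  · rw [bellman_player1 f hv hk, step_player1 _ _ _ hk, Strategy.ofFun_move, sum_pure_mul]
    exact iSup₂_le fun w hw => add_le_add_right ((hc v).2 w hw) _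
  · rw [bellman_player2 f hv hk]
    obtain ⟨d, hd⟩ := G.exists_argmin f
    refine (iInf₂_le (d v) (hd v).1).trans (add_le_add_right ?_ _)
    calc f (d v) = ∑ w, step (Strategy.ofFun c fun v _ => (hc v).1 : G.Strategy1) σ₂ h v w *
          f (d v) := by rw [← Finset.sum_mul, sum_step, one_mul]
      _ ≤ _ := by
        refine Finset.sum_le_sum fun w _ => ?_
        by_cases hw : w ∈ G.post v
        · exact mul_le_mul_right ((hd v).2 w hw) _
        · rw [step_apply_eq_zero _ _ _ hw, zero_mul, zero_mul]
  · rw [bellman_random f hv hk, step_random _ _ _ hk]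
    rfl

/-- A Player 2 that minimizes `f` makes the mean of `f` after one step at most what the Bellman
functional says. -/
theorem step_le_bellman {f : V → ℝ≥0∞} {c : V → V}
    (hc : ∀ v, c v ∈ G.post v ∧ ∀ w ∈ G.post v, f (c v) ≤ f w) (σ₁ : G.Strategy1)
    {σ₂ : G.Strategy2} {h : List V} (hσ₂ : ∀ v, σ₂.move h v = PMF.pure (c v)) {v : V}
    (hv : v ∉ G.terminal) : G.r v + ∑ w, step σ₁ σ₂ h v w * f w ≤ G.bellman f v := by
  rcases hk : G.kind v
  · rw [bellman_player1 f hv hk]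
    obtain ⟨d, hd⟩ := G.exists_argmax f
    refine le_trans (add_le_add_right ?_ _)
      (le_iSup₂_of_le (f := fun v' _ => (G.r v : ℝ≥0∞) + f v') (d v) (hd v).1 le_rfl)
    calc ∑ w, step σ₁ σ₂ h v w * f w ≤ ∑ w, step σ₁ σ₂ h v w * f (d v) := by
          refine Finset.sum_le_sum fun w _ => ?_
          by_cases hw : w ∈ G.post v
          · exact mul_le_mul_right ((hd v).2 w hw) _
          · rw [step_apply_eq_zero _ _ _ hw, zero_mul, zero_mul]
      _ = f (d v) := by rw [← Finset.sum_mul, sum_step, one_mul]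
  · rw [bellman_player2 f hv hk, step_player2 _ _ _ hk, hσ₂, sum_pure_mul]
    exact le_iInf₂ fun w hw => add_le_add_right ((hc v).2 w hw) _
  · rw [bellman_random f hv hk, step_random _ _ _ hk]
    rfl

end Bellman

/-! ### Subsolutions, finiteness of the values, and the Bellman inequality for the upper value. -/

section Values

variable {V : Type*} [Fintype V] {G : RewardGame V} [MeasurableSpace V]
  [DiscreteMeasurableSpace V]

theorem measurable_rew : Measurable G.rew :=
  Measurable.tsum fun n => measurable_comp_eval (fun v => (G.r v : ℝ≥0∞)) n

theorem expRew_eq (σ₁ : G.Strategy1) (σ₂ : G.Strategy2) (v : V) :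
    G.expRew σ₁ σ₂ v = G.r v +
      ∑ w, step σ₁ σ₂ [] v w * G.expRew (σ₁.tail v) (σ₂.tail v) w := by
  rw [expRew, lintegral_prob _ _ _ measurable_rew]
  simp only [rew_prependSeq, lintegral_add_left measurable_const, lintegral_const, measure_univ,
    mul_one, mul_add, Finset.sum_add_distrib, ← Finset.sum_mul, sum_step, one_mul]
  rfl

theorem expRew_terminal (σ₁ : G.Strategy1) (σ₂ : G.Strategy2) {v : V} (hv : v ∈ G.terminal) :
    G.expRew σ₁ σ₂ v = 0 := by
  refine (lintegral_congr_ae ?_).trans lintegral_zero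
  filter_upwards [ae_prob_zero σ₁ σ₂ v, ae_prob_mem_paths σ₁ σ₂ v] with ω h0 hω
  refine ENNReal.tsum_eq_zero.2 fun n => ?_
  rw [eq_of_mem_terminal_of_le hω (n := 0) (by rwa [h0]) n (Nat.zero_le n), h0,
    G.r_terminal v hv, ENNReal.coe_zero]

/-- Iterate `bellman_le_step`. Player 2 may use history, so the induction runs over all `σ₂`; the
memoryless strategy of Player 1 is its own tail. -/
theorem le_lintegral_sum_range_add {f : V → ℝ≥0∞} (hf : f ≤ G.bellman f) {c : V → V}
    (hc : ∀ v, c v ∈ G.post v ∧ ∀ w ∈ G.post v, f w ≤ f (c v)) (n : ℕ) (σ₂ : G.Strategy2)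
    (v : V) :
    f v ≤ ∫⁻ ω, (∑ k ∈ Finset.range n, (G.r (ω k) : ℝ≥0∞) + f (ω n))
      ∂prob (Strategy.ofFun c fun v _ => (hc v).1) σ₂ v := by
  induction n generalizing σ₂ v with
  | zero =>
    refine le_of_eq ?_
    calc f v = ∫⁻ _, f v ∂prob (Strategy.ofFun c fun v _ => (hc v).1) σ₂ v := by
          rw [lintegral_const, measure_univ, mul_one]
      _ = _ := lintegral_congr_ae (by
          filter_upwards [ae_prob_zero (Strategy.ofFun c fun v _ => (hc v).1) σ₂ v] with ω hω
          simp [hω])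
  | succ n ih =>
    have hm : Measurable fun ω : ℕ → V =>
        ∑ k ∈ Finset.range (n + 1), (G.r (ω k) : ℝ≥0∞) + f (ω (n + 1)) :=
      (Finset.measurable_fun_sum _ fun k _ =>
        measurable_comp_eval (fun v => (G.r v : ℝ≥0∞)) k).add (measurable_comp_eval f (n + 1))
    rw [lintegral_prob _ _ _ hm]
    simp only [sum_range_succ_prependSeq (fun v => (G.r v : ℝ≥0∞)), Strategy.ofFun_tail, add_assoc]
    refine ((hf v).trans (bellman_le_step hc σ₂ [] v)).trans ?_
    simp only [lintegral_add_left measurable_const, lintegral_const, measure_univ,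
      mul_one, mul_add, Finset.sum_add_distrib, ← Finset.sum_mul, sum_step, one_mul]
    exact add_le_add_right (Finset.sum_le_sum fun w _ => mul_le_mul_right (ih _ w) _) _

/-- A finite `f` below its Bellman image is guaranteed by a deterministic memoryless strategy of
Player 1 against all fair strategies. -/
theorem exists_detMemoryless1_forall_le_expRew (hG : G.StoppingUnderFairness) {f : V → ℝ≥0∞}
    (hf : f ≤ G.bellman f) (hfin : ∀ v, f v ≠ ⊤) :
    ∃ σ₁ ∈ G.detMemoryless1, ∀ σ₂ ∈ G.fairStrategies, ∀ v, f v ≤ G.expRew σ₁ σ₂ v := by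
  obtain ⟨c, hc⟩ := G.exists_argmax f
  refine ⟨Strategy.ofFun c fun v _ => (hc v).1,
    ⟨Strategy.ofFun_deterministic _ _, Strategy.ofFun_memoryless _ _⟩, fun σ₂ hσ₂ v => ?_⟩
  generalize hσ : (Strategy.ofFun c fun v _ => (hc v).1 : G.Strategy1) = σ₁
  have hf0 : ∀ v ∈ G.terminal, f v = 0 := fun v hv =>
    le_antisymm ((hf v).trans (bellman_terminal f hv).le) zero_le
  have hlim : Filter.Tendsto (fun n => ∫⁻ ω, f (ω n) ∂prob σ₁ σ₂ v) Filter.atTop (nhds 0) := by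
    have := tendsto_lintegral_of_dominated_convergence (μ := prob σ₁ σ₂ v)
      (F := fun n ω => f (ω n)) (f := fun _ => 0) (fun _ => ∑ w, f w)
      (fun n => measurable_comp_eval f n)
      (fun n => Filter.Eventually.of_forall fun ω =>
        Finset.single_le_sum (f := f) (fun _ _ => zero_le) (Finset.mem_univ (ω n)))
      (by
        rw [lintegral_const, measure_univ, mul_one]
        exact ENNReal.sum_ne_top.2 fun w _ => hfin w)
      (by
        filter_upwards [hG.ae_mem_terminal σ₁ hσ₂ v, ae_prob_mem_paths σ₁ σ₂ v] with ω ⟨n, hn⟩ hω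
        refine tendsto_const_nhds.congr' ?_
        filter_upwards [Filter.eventually_ge_atTop n] with m hm
        rw [eq_of_mem_terminal_of_le hω hn m hm, hf0 _ hn])
    simpa using this
  have hle : ∀ n, f v ≤ G.expRew σ₁ σ₂ v + ∫⁻ ω, f (ω n) ∂prob σ₁ σ₂ v := by
    intro n
    refine (le_lintegral_sum_range_add hf hc n σ₂ v).trans ?_
    rw [hσ, lintegral_add_right _ (measurable_comp_eval f n)]
    exact add_le_add_left (lintegral_mono fun ω => ENNReal.sum_le_tsum _) _
  have := ge_of_tendsto' (hlim.const_add (G.expRew σ₁ σ₂ v)) hle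
  rwa [add_zero] at this

theorem le_lowerValue (hG : G.StoppingUnderFairness) {f : V → ℝ≥0∞} (hf : f ≤ G.bellman f)
    (hfin : ∀ v, f v ≠ ⊤) (v : V) : f v ≤ G.lowerValue v := by
  obtain ⟨σ₁, -, h⟩ := exists_detMemoryless1_forall_le_expRew hG hf hfin
  exact le_iSup_of_le σ₁ (le_iInf₂ fun σ₂ hσ₂ => h σ₂ hσ₂ v)

/-- The guaranteeing strategy belongs to the class over which the supremum in `U` runs, and the
opponents in `U` are fair. -/
theorem le_bound (hG : G.StoppingUnderFairness) {f : V → ℝ≥0∞} (hf : f ≤ G.bellman f)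
    (hfin : ∀ v, f v ≠ ⊤) (v : V) : f v ≤ G.bound := by
  obtain ⟨σ₁, hσ₁, h⟩ := exists_detMemoryless1_forall_le_expRew hG hf hfin
  exact le_iSup_of_le v (le_iInf₂ fun σ₂ hσ₂ => le_iSup₂_of_le σ₁ hσ₁ (h σ₂ hσ₂.2.2 v))

theorem lowerValue_le_upperValue (v : V) : G.lowerValue v ≤ G.upperValue v :=
  iSup_le fun σ₁ => le_iInf₂ fun σ₂ hσ₂ => (iInf₂_le σ₂ hσ₂).trans
    (le_iSup (fun σ₁ => G.expRew σ₁ σ₂ v) σ₁)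

theorem exists_detMemorylessFair2_expRew_le (hG : G.StoppingUnderFairness) :
    ∃ σ₂ ∈ G.detMemorylessFair2, ∃ g : V → ℝ≥0, ∀ (σ₁ : G.Strategy1) (v : V),
      G.expRew σ₁ σ₂ v ≤ g v := by
  classical
  -- This cost per nonterminal step dominates every reward; the `1` keeps it positive when all
  -- rewards vanish.
  have hR : (0 : ℝ≥0) < ∑ v, G.r v + 1 := add_pos_of_nonneg_of_pos zero_le one_pos
  obtain ⟨σ₂, hσ₂, g, hg⟩ :=
    StochasticGame.StoppingUnderFairness.exists_detMemorylessFair2 hG hR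
  refine ⟨σ₂, hσ₂, g, fun σ₁ v => (lintegral_mono fun ω => ENNReal.tsum_le_tsum fun n => ?_).trans
    (hg σ₁ v)⟩
  split_ifs with h
  · rw [G.r_terminal _ h, ENNReal.coe_zero]
  · rw [ENNReal.coe_le_coe]
    exact (Finset.single_le_sum (f := G.r) (fun _ _ => zero_le)
      (Finset.mem_univ (ω n))).trans (le_add_of_nonneg_right zero_le)

theorem bound_ne_top (hG : G.StoppingUnderFairness) : G.bound ≠ ⊤ := by
  obtain ⟨σ₂, hσ₂, g, hg⟩ := exists_detMemorylessFair2_expRew_le hG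
  refine ne_top_of_le_ne_top (ENNReal.coe_ne_top (r := ∑ v, g v)) (iSup_le fun v => ?_)
  refine (iInf₂_le σ₂ hσ₂).trans (iSup₂_le fun σ₁ _ => (hg σ₁ v).trans ?_)
  exact ENNReal.coe_le_coe.2 (Finset.single_le_sum (fun _ _ => zero_le) (Finset.mem_univ v))

theorem upperValue_ne_top (hG : G.StoppingUnderFairness) (v : V) : G.upperValue v ≠ ⊤ := by
  obtain ⟨σ₂, hσ₂, g, hg⟩ := exists_detMemorylessFair2_expRew_le hG
  exact ne_top_of_le_ne_top ENNReal.coe_ne_top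
    ((iInf₂_le σ₂ hσ₂.2.2).trans (iSup_le fun σ₁ => hg σ₁ v))

/-- Player 2 can do one minimizing step and then follow nearly optimal fair strategies. -/
theorem upperValue_le_bellman (hG : G.StoppingUnderFairness) :
    G.upperValue ≤ G.bellman G.upperValue := by
  intro v
  by_cases hv : v ∈ G.terminal
  · obtain ⟨σ₂, hσ₂⟩ := G.nonempty_fairStrategies
    exact (iInf₂_le σ₂ hσ₂).trans (iSup_le fun σ₁ => (expRew_terminal σ₁ σ₂ hv).le.trans zero_le)
  refine ENNReal.le_of_forall_pos_le_add fun ε hε _ => ?_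
  -- The nearly optimal strategy may depend on the starting vertex `w`, hence the family `τ`.
  -- Minimizing `upperValue` at every step is not an option, as such a strategy need not be fair.
  have hτ : ∀ w, ∃ τ ∈ G.fairStrategies, ∀ σ₁, G.expRew σ₁ τ w ≤ G.upperValue w + ε := by
    intro w
    have hlt : G.upperValue w < G.upperValue w + ε :=
      ENNReal.lt_add_right (upperValue_ne_top hG w) (by exact_mod_cast hε.ne')
    obtain ⟨τ, hτ⟩ := iInf_lt_iff.1 hlt
    obtain ⟨hfair, hτ⟩ := iInf_lt_iff.1 hτ
    exact ⟨τ, hfair, fun σ₁ => (le_iSup (fun σ₁ => G.expRew σ₁ τ w) σ₁).trans hτ.le⟩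
  choose τ hfair hτ using hτ
  obtain ⟨c, hc⟩ := G.exists_argmin G.upperValue
  refine (iInf₂_le _ (consFamily_mem_fairStrategies c (fun v _ => (hc v).1) hfair)).trans
    (iSup_le fun σ₁ => ?_)
  generalize hσ : Strategy.consFamily c (fun v _ => (hc v).1) τ = σ₂
  have htail : ∀ w, G.expRew (σ₁.tail v) (σ₂.tail v) w ≤ G.upperValue w + ε := by
    intro w
    refine le_trans (le_of_eq ?_) (hτ w (σ₁.tail v))
    rw [expRew, ← hσ, prob_consFamily_tail]
    rfl
  calc G.expRew σ₁ σ₂ v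
      ≤ G.r v + ∑ w, step σ₁ σ₂ [] v w * (G.upperValue w + ε) := by
        rw [expRew_eq]
        exact add_le_add_right (Finset.sum_le_sum fun w _ => mul_le_mul_right (htail w) _) _
    _ = G.r v + ∑ w, step σ₁ σ₂ [] v w * G.upperValue w + ε := by
        simp only [mul_add, Finset.sum_add_distrib, ← Finset.sum_mul, sum_step, one_mul, add_assoc]
    _ ≤ G.bellman G.upperValue v + ε :=
        add_le_add_left (step_le_bellman hc σ₁ (fun w => by rw [← hσ]; rfl) hv) _

end Values

end RewardGame

theorem mainTheorem1 {V : Type*} [Fintype V] [MeasurableSpace V] [DiscreteMeasurableSpace V]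
    (G : RewardGame V) (hG : G.StoppingUnderFairness) :
    G.bound ≠ ⊤ ∧
      ∃ ν : V → ℝ≥0∞, IsGreatest G.bellmanFixedPoints ν ∧
        ∀ v : V, G.upperValue v = G.lowerValue v ∧ G.lowerValue v = ν v := by
  have hle := RewardGame.upperValue_le_bellman hG
  have hfin := RewardGame.upperValue_ne_top hG
  have heq : G.upperValue = G.lowerValue := funext fun v =>
    le_antisymm (RewardGame.le_lowerValue hG hle hfin v) (RewardGame.lowerValue_le_upperValue v)
  have hfix : G.bellman G.upperValue = G.upperValue := by
    -- Monotonicity makes the Bellman image of the upper value another finite subsolution, so it too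
    -- lies below the lower value.
    refine le_antisymm (fun v => ?_) hle
    exact (RewardGame.le_lowerValue hG (RewardGame.bellman_mono hle)
      (RewardGame.bellman_ne_top hfin) v).trans (RewardGame.lowerValue_le_upperValue v)
  refine ⟨RewardGame.bound_ne_top hG, G.upperValue,
    ⟨⟨RewardGame.le_bound hG hle hfin, hfix⟩, fun f hf v => ?_⟩,
    fun v => ⟨congrFun heq v, (congrFun heq v).symm⟩⟩
  exact (RewardGame.le_lowerValue hG hf.2.ge
    (fun w => ne_top_of_le_ne_top (RewardGame.bound_ne_top hG) (hf.1 w)) v).trans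
    (RewardGame.lowerValue_le_upperValue v)
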